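/- Let $\mathcal G=(\mathcal V,\mathcal E,\mathcal W)$ be a finite connected undirected simple graph with nonzero real (possibly negative) edge weights $\mathcal W:\mathcal E\to\mathbb R\setminus\{0\}$, let $W=\operatorname{diag}(\mathcal W(e))_{e\in\mathcal E}$, fix an arbitrary orientation of the edges, and let $E\in\mathbb R^{|\mathcal V|\times|\mathcal E|}$ be the corresponding incidence matrix (the column of an edge has entry $1$ at its tail, $-1$ at its head and $0$ elsewhere). Let $L(\mathcal G)=EWE^T$ be the weighted Laplacian, and assume that its signature is $\sigma(L(\mathcal G))=(n_+,n_-,1)$ for some $n_+,n_-$, i.e. it has $n_+$ positive, $n_-$ negative and exactly one zero eigenvalue, counted with multiplicity. Let $\mathcal T\subseteq\mathcal G$ be a spanning tree and $\mathcal C=\mathcal G\setminus\mathcal T$ the subgraph of the remaining edges; order the edges so that $E=[\,E_{\mathcal T}\ \ E_{\mathcal C}\,]$. Put $$L_e(\mathcal T)=E_{\mathcal T}^TE_{\mathcal T},\quad E_{\mathcal T}^L=L_e(\mathcal T)^{-1}E_{\mathcal T}^T,\quad R=[\,I\ \ E_{\mathcal T}^LE_{\mathcal C}\,],\quad L_{ess}(\mathcal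 T)=L_e(\mathcal T)\,RWR^T .$$ Then $L_e(\mathcal T)$, $RWR^T$ and $L_{ess}(\mathcal T)$ are invertible, $E_{\mathcal T}^L$ is a left inverse of $E_{\mathcal T}$, that is $E_{\mathcal T}^LE_{\mathcal T}=I$, and the Moore–Penrose pseudo-inverse of the weighted Laplacian is $$L^\dagger(\mathcal G)=(E_{\mathcal T}^L)^T\,(RWR^T)^{-1}\,E_{\mathcal T}^L=(E_{\mathcal T}^L)^T\,L_{ess}(\mathcal T)^{-1}\,E_{\mathcal T}^T .$$ Consequently, for all nodes $u,v\in\mathcal V$, the effective resistance $\mathcal R_{uv}(\mathcal G):=(\mathbf e_u-\mathbf e_v)^TL^\dagger(\mathcal G)(\mathbf e_u-\mathbf e_v)$, where $\mathbf e_u$ is the indicator vector of $u$, satisfies $$\mathcal R_{uv}(\mathcal G)=(\mathbf e_u-\mathbf e_v)^T(E_{\mathcal T}^L)^T(RWR^T)^{-1}E_{\mathcal T}^L(\mathbf e_u-\mathbf e_v).$$ -/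

import Mathlib

open Matrix

namespace SignedLaplacian

section PseudoInverse

variable {m n : Type*} [Fintype m] [Fintype n]

/-- The four Penrose equations: `X` is a Moore–Penrose pseudo-inverse of the real matrix `A`. -/
structure IsMoorePenrose (A : Matrix m n ℝ) (X : Matrix n m ℝ) : Prop where
  mul_mul_self : A * X * A = A
  self_mul_mul : X * A * X = X
  symm_left : (A * X)ᵀ = A * X
  symm_right : (X * A)ᵀ = X * A

theorem IsMoorePenrose.unique {A : Matrix m n ℝ} {X Y : Matrix n m ℝ}
    (hX : IsMoorePenrose A X) (hY : IsMoorePenrose A Y) : X = Y := by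
  have hA : A * X = A * Y := by
    calc A * X = (A * X)ᵀ := hX.symm_left.symm
      _ = (A * Y * A * X)ᵀ := by rw [hY.mul_mul_self]
      _ = (A * X)ᵀ * (A * Y)ᵀ := by rw [← transpose_mul]; simp only [Matrix.mul_assoc]
      _ = A * X * A * Y := by rw [hX.symm_left, hY.symm_left]; simp only [Matrix.mul_assoc]
      _ = A * Y := by rw [hX.mul_mul_self]
  have hB : X * A = Y * A := by
    calc X * A = (X * A)ᵀ := hX.symm_right.symm
      _ = (X * (A * Y * A))ᵀ := by rw [hY.mul_mul_self]
      _ = (Y * A)ᵀ * (X * A)ᵀ := by rw [← transpose_mul]; simp only [Matrix.mul_assoc]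
      _ = Y * (A * X * A) := by rw [hX.symm_right, hY.symm_right]; simp only [Matrix.mul_assoc]
      _ = Y * A := by rw [hX.mul_mul_self]
  calc X = X * A * X := hX.self_mul_mul.symm
    _ = Y * (A * Y) := by rw [hB, Matrix.mul_assoc, hA]
    _ = Y := by rw [← Matrix.mul_assoc, hY.self_mul_mul]

/-- Symmetric real matrices have a symmetric Moore–Penrose pseudo-inverse. -/
theorem exists_isMoorePenrose_of_isHermitian [DecidableEq n] {H : Matrix n n ℝ}
    (hH : H.IsHermitian) : ∃ X : Matrix n n ℝ, IsMoorePenrose H X ∧ Xᵀ = X := by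
  obtain ⟨U, d, hU, hHU⟩ : ∃ (U : Matrix n n ℝ) (d : n → ℝ),
      Uᵀ * U = 1 ∧ H = U * diagonal d * Uᵀ := by
    refine ⟨hH.eigenvectorUnitary, hH.eigenvalues, ?_, ?_⟩
    · have := Unitary.coe_star_mul_self hH.eigenvectorUnitary
      simpa [star_eq_conjTranspose, conjTranspose_eq_transpose_of_trivial] using this
    · have := hH.spectral_theorem
      simpa [Unitary.conjStarAlgAut_apply, star_eq_conjTranspose,
        conjTranspose_eq_transpose_of_trivial, Function.comp_def] using this
  have key : ∀ a b : n → ℝ, (U * diagonal a * Uᵀ) * (U * diagonal b * Uᵀ)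
      = U * diagonal (fun i => a i * b i) * Uᵀ := by
    intro a b
    calc _ = U * diagonal a * (Uᵀ * U) * diagonal b * Uᵀ := by simp only [Matrix.mul_assoc]
      _ = _ := by rw [hU, Matrix.mul_one, Matrix.mul_assoc U, diagonal_mul_diagonal]
  have tr : ∀ a : n → ℝ, (U * diagonal a * Uᵀ)ᵀ = U * diagonal a * Uᵀ := by
    intro a; simp [transpose_mul, Matrix.mul_assoc]
  refine ⟨U * diagonal (fun i => (d i)⁻¹) * Uᵀ, ⟨?_, ?_, ?_, ?_⟩, tr _⟩
  · rw [hHU, key, key]; congr 3; ext i; exact mul_inv_mul_cancel (d i)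
  · rw [hHU, key, key]; congr 3; ext i; rw [mul_assoc]; by_cases h : d i = 0 <;> simp [h]
  · rw [hHU, key, tr]
  · rw [hHU, key, tr]

theorem exists_isMoorePenrose (A : Matrix m n ℝ) : ∃ X : Matrix n m ℝ, IsMoorePenrose A X := by
  classical
  have hH : (Aᵀ * A).IsHermitian := by
    simp [IsHermitian, conjTranspose_eq_transpose_of_trivial, transpose_mul]
  obtain ⟨G, hG, hGt⟩ := exists_isMoorePenrose_of_isHermitian hH
  have hz : A * (1 - G * (Aᵀ * A)) = 0 := by
    apply conjTranspose_mul_self_eq_zero.1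
    rw [conjTranspose_eq_transpose_of_trivial, transpose_mul]
    have : Aᵀ * (A * (1 - G * (Aᵀ * A))) = 0 := by
      rw [Matrix.mul_sub, Matrix.mul_sub, Matrix.mul_one, sub_eq_zero]
      calc Aᵀ * A = Aᵀ * A * G * (Aᵀ * A) := hG.mul_mul_self.symm
        _ = _ := by simp only [Matrix.mul_assoc]
    rw [Matrix.mul_assoc, this, Matrix.mul_zero]
  refine ⟨G * Aᵀ, ⟨?_, ?_, ?_, ?_⟩⟩
  · rw [Matrix.mul_sub, Matrix.mul_one, sub_eq_zero] at hz
    conv_rhs => rw [hz]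
    simp only [Matrix.mul_assoc]
  · conv_rhs => rw [← hG.self_mul_mul]
    simp only [Matrix.mul_assoc]
  · simp [transpose_mul, hGt, Matrix.mul_assoc]
  · have := hG.symm_right
    rwa [← Matrix.mul_assoc] at this

/-- The Moore–Penrose pseudo-inverse `A†` of a real matrix. -/
noncomputable def pinv (A : Matrix m n ℝ) : Matrix n m ℝ :=
  Classical.choose (exists_isMoorePenrose A)

theorem pinv_spec (A : Matrix m n ℝ) : IsMoorePenrose A (pinv A) :=
  Classical.choose_spec (exists_isMoorePenrose A)

/-- The signature `σ(A) = (n₊, n₋, n₀)` of a real symmetric matrix: the numbers of positive,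
negative and zero eigenvalues, counted with multiplicity. -/
noncomputable def signature [DecidableEq n] (A : Matrix n n ℝ) (hA : A.IsHermitian) : ℕ × ℕ × ℕ :=
  ((Finset.univ.filter fun i => 0 < hA.eigenvalues i).card,
   (Finset.univ.filter fun i => hA.eigenvalues i < 0).card,
   (Finset.univ.filter fun i => hA.eigenvalues i = 0).card)

end PseudoInverse

section Graph

variable {V : Type*}

/-- An orientation of the edges of an undirected graph. -/
structure Orientation (G : SimpleGraph V) where
  tail : G.edgeSet → V
  head : G.edgeSet → V
  mk_tail_head : ∀ e, s(tail e, head e) = (e : Sym2 V)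

/-- The orientation that a subgraph inherits. -/
def Orientation.restrict {G H : SimpleGraph V} (o : Orientation G) (h : H ≤ G) :
    Orientation H where
  tail e := o.tail ⟨e, SimpleGraph.edgeSet_mono h e.2⟩
  head e := o.head ⟨e, SimpleGraph.edgeSet_mono h e.2⟩
  mk_tail_head e := o.mk_tail_head ⟨e, SimpleGraph.edgeSet_mono h e.2⟩

variable [DecidableEq V]

/-- The (oriented) incidence matrix `E(G)`, of size `|V| × |E|`. -/
def incidence {G : SimpleGraph V} (o : Orientation G) : Matrix V G.edgeSet ℝ :=
  Matrix.of fun v e => if v = o.tail e then 1 else if v = o.head e then -1 else 0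

/-- The weighted Laplacian `L(G) = E W Eᵀ`, with `W` the diagonal matrix of the edge weights. -/
def laplacian [Fintype V] {G : SimpleGraph V} [DecidableRel G.Adj] (o : Orientation G)
    (w : G.edgeSet → ℝ) : Matrix V V ℝ :=
  incidence o * diagonal w * (incidence o)ᵀ

theorem laplacian_isHermitian [Fintype V] {G : SimpleGraph V} [DecidableRel G.Adj]
    (o : Orientation G) (w : G.edgeSet → ℝ) : (laplacian o w).IsHermitian := by
  simp [IsHermitian, laplacian, conjTranspose_eq_transpose_of_trivial, transpose_mul,
    Matrix.mul_assoc]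

/-- The effective resistance `(e_u - e_v)ᵀ L† (e_u - e_v)` between two nodes. -/
noncomputable def effectiveResistance [Fintype V] {G : SimpleGraph V} [DecidableRel G.Adj]
    (o : Orientation G) (w : G.edgeSet → ℝ) (u v : V) : ℝ :=
  (Pi.single u 1 - Pi.single v 1) ⬝ᵥ
    (pinv (laplacian o w) *ᵥ (Pi.single u 1 - Pi.single v 1))

variable [Fintype V] {G T : SimpleGraph V} [DecidableRel T.Adj]

/-- The edge Laplacian `L_e(T) = E_Tᵀ E_T` of an (unweighted) oriented graph. -/
def edgeLaplacian (o : Orientation T) : Matrix T.edgeSet T.edgeSet ℝ :=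
  (incidence o)ᵀ * incidence o

/-- The matrix `E_T^L = L_e(T)⁻¹ E_Tᵀ`. -/
noncomputable def leftInverse (o : Orientation T) : Matrix T.edgeSet V ℝ :=
  (edgeLaplacian o)⁻¹ * (incidence o)ᵀ

/-- The edges of `G` are those of the subgraph `T` followed by those of the cycle subgraph
`C = G \ T`. -/
def edgeSplit (h : T ≤ G) : T.edgeSet ⊕ (G \ T).edgeSet ≃ G.edgeSet :=
  (Equiv.sumCongr (Equiv.refl _) (Equiv.setCongr (SimpleGraph.edgeSet_sdiff G T))).trans
    (Equiv.Set.sumDiffSubset (SimpleGraph.edgeSet_mono h))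

/-- `R = [I  L_e(T)⁻¹ E_Tᵀ E_C]`, with columns indexed by the edges of `G`. -/
noncomputable def cutMatrix (o : Orientation G) (h : T ≤ G) : Matrix T.edgeSet G.edgeSet ℝ :=
  (fromCols 1 ((edgeLaplacian (o.restrict h))⁻¹ * (incidence (o.restrict h))ᵀ *
    incidence (o.restrict (sdiff_le : G \ T ≤ G)))).submatrix id (edgeSplit h).symm

/-- The matrix `R W Rᵀ`. -/
noncomputable def weightedCutGram [DecidableRel G.Adj] (o : Orientation G) (w : G.edgeSet → ℝ)
    (h : T ≤ G) : Matrix T.edgeSet T.edgeSet ℝ :=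
  cutMatrix o h * diagonal w * (cutMatrix o h)ᵀ

/-- The essential edge Laplacian `L_ess(T) = L_e(T) R W Rᵀ`. -/
noncomputable def essentialEdgeLaplacian [DecidableRel G.Adj] (o : Orientation G)
    (w : G.edgeSet → ℝ) (h : T ≤ G) : Matrix T.edgeSet T.edgeSet ℝ :=
  edgeLaplacian (o.restrict h) * weightedCutGram o w h

end Graph

end SignedLaplacian

/-!
For a spanning tree `T` (more generally, a maximal acyclic subgraph) every edge of `T` is a bridge,
so the indicators of its fundamental cuts form a left inverse of `E_T`; hence `E_Tᵀ E_T` is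
invertible. The kernel of `E_Tᵀ` consists of the functions constant on the components of `T`, which
are those of `G`, so `E_T E_T^L` is the orthogonal projection onto a space containing the columns
of `E`. Since `R = E_T^L E`, this gives `E = E_T R` and `L = E_T (R W Rᵀ) E_Tᵀ`. As `E_T` is
injective, `R W Rᵀ` has the rank of `L`, so it is invertible exactly when the nullity of `L` is the
number of components, and then the Penrose equations for `(E_T^L)ᵀ (R W Rᵀ)⁻¹ E_T^L` only use
`E_T^L E_T = 1` and the symmetry of `E_T E_T^L`.
-/

namespace SignedLaplacian

section LeftInverse

variable {R m n p : Type*} [CommRing R] [Fintype m] [Fintype n] [DecidableEq n]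

theorem rank_eq_card_of_mul_eq_one [Nontrivial R] {A : Matrix m n R} {B : Matrix n m R}
    (hBA : B * A = 1) : A.rank = Fintype.card n := by
  refine le_antisymm A.rank_le_card_width ?_
  calc Fintype.card n = (B * A).rank := by rw [hBA, rank_one]
    _ ≤ A.rank := rank_mul_le_right B A

theorem rank_mul_mul_transpose_of_mul_eq_one [Nontrivial R] {A : Matrix m n R} {B : Matrix n m R}
    (hBA : B * A = 1) (N : Matrix n n R) : (A * N * Aᵀ).rank = N.rank := by
  have hAB : Aᵀ * Bᵀ = 1 := by rw [← transpose_mul, hBA, transpose_one]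
  refine le_antisymm ((rank_mul_le_left _ _).trans (rank_mul_le_right _ _)) ?_
  calc N.rank = (B * A * N * (Aᵀ * Bᵀ)).rank := by rw [hBA, hAB, Matrix.one_mul, Matrix.mul_one]
    _ = (B * (A * N * Aᵀ) * Bᵀ).rank := by simp only [Matrix.mul_assoc]
    _ ≤ (A * N * Aᵀ).rank := (rank_mul_le_left _ _).trans (rank_mul_le_right _ _)

theorem mul_mul_eq_of_ker_transpose_le {A : Matrix m n R} {B : Matrix n m R}
    {C : Matrix m p R} (hBA : B * A = 1) (hAB : (A * B).IsSymm)
    (hker : ∀ x, Aᵀ *ᵥ x = 0 → Cᵀ *ᵥ x = 0) : A * B * C = C := by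
  classical
  have hA : Aᵀ * (1 - A * B) = 0 := by
    rw [Matrix.mul_sub, Matrix.mul_one, ← hAB.eq, ← transpose_mul, Matrix.mul_assoc, hBA,
      Matrix.mul_one, sub_self]
  have hC : Cᵀ * (1 - A * B) = 0 := by
    ext i j
    have hAj : Aᵀ *ᵥ (1 - A * B).col j = 0 := funext fun k => congrFun (congrFun hA k) j
    exact congrFun (hker _ hAj) i
  rw [Matrix.mul_sub, Matrix.mul_one, ← hAB.eq, ← transpose_mul, sub_eq_zero] at hC
  exact (transpose_injective hC).symm

theorem isMoorePenrose_mul_mul_transpose {A : Matrix m n ℝ} {B : Matrix n m ℝ} {N : Matrix n n ℝ}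
    (hBA : B * A = 1) (hAB : (A * B).IsSymm) (hN : IsUnit N) :
    IsMoorePenrose (A * N * Aᵀ) (Bᵀ * N⁻¹ * B) := by
  have hdet : IsUnit N.det := (isUnit_iff_isUnit_det N).1 hN
  have hBA' : Aᵀ * Bᵀ = 1 := by rw [← transpose_mul, hBA, transpose_one]
  have hleft : A * N * Aᵀ * (Bᵀ * N⁻¹ * B) = A * B :=
    calc _ = A * N * (Aᵀ * Bᵀ) * N⁻¹ * B := by simp only [Matrix.mul_assoc]
      _ = A * (N * N⁻¹) * B := by rw [hBA', Matrix.mul_one, Matrix.mul_assoc A]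
      _ = A * B := by rw [mul_nonsing_inv N hdet, Matrix.mul_one]
  have hright : Bᵀ * N⁻¹ * B * (A * N * Aᵀ) = A * B :=
    calc _ = Bᵀ * N⁻¹ * (B * A) * N * Aᵀ := by simp only [Matrix.mul_assoc]
      _ = Bᵀ * (N⁻¹ * N) * Aᵀ := by rw [hBA, Matrix.mul_one, Matrix.mul_assoc Bᵀ]
      _ = A * B := by rw [nonsing_inv_mul N hdet, Matrix.mul_one, ← transpose_mul, hAB.eq]
  constructor
  · calc _ = A * B * (A * N * Aᵀ) := by rw [hleft]
      _ = A * (B * A) * N * Aᵀ := by simp only [Matrix.mul_assoc]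
      _ = A * N * Aᵀ := by rw [hBA, Matrix.mul_one]
  · calc _ = (A * B)ᵀ * (Bᵀ * N⁻¹ * B) := by rw [hright, hAB.eq]
      _ = Bᵀ * (Aᵀ * Bᵀ) * N⁻¹ * B := by simp only [transpose_mul, Matrix.mul_assoc]
      _ = Bᵀ * N⁻¹ * B := by rw [hBA', Matrix.mul_one]
  · rw [hleft, hAB.eq]
  · rw [hright, hAB.eq]

end LeftInverse

section Rank

variable {n : Type*} [Fintype n] [DecidableEq n]

theorem isUnit_iff_rank_eq_card {K : Type*} [Field K] {N : Matrix n n K} :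
    IsUnit N ↔ N.rank = Fintype.card n := by
  rw [← linearIndependent_cols_iff_isUnit, linearIndependent_iff_card_eq_finrank_span,
    Set.finrank, ← rank_eq_finrank_span_cols, eq_comm]

theorem rank_add_signature_zero {A : Matrix n n ℝ} (hA : A.IsHermitian) :
    A.rank + (signature A hA).2.2 = Fintype.card n := by
  rw [hA.rank_eq_card_non_zero_eigs, Fintype.card_subtype, signature, add_comm]
  exact Finset.card_filter_add_card_filter_not (s := Finset.univ) fun i => hA.eigenvalues i = 0

end Rank

section Incidence

variable {V : Type*} {G : SimpleGraph V}

theorem Orientation.adj_tail_head (o : Orientation G) (e : G.edgeSet) :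
    G.Adj (o.tail e) (o.head e) := by
  rw [← SimpleGraph.mem_edgeSet, o.mk_tail_head]
  exact e.2

theorem Orientation.forall_tail_eq_head_iff {α : Type*} (o : Orientation G) {x : V → α} :
    (∀ e, x (o.tail e) = x (o.head e)) ↔ ∀ u v, G.Adj u v → x u = x v := by
  refine ⟨fun h u v huv => ?_, fun h e => h _ _ (o.adj_tail_head e)⟩
  have he := h ⟨s(u, v), huv⟩
  rcases Sym2.eq_iff.1 (o.mk_tail_head ⟨s(u, v), huv⟩) with ⟨htail, hhead⟩ | ⟨htail, hhead⟩
  · rwa [htail, hhead] at he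
  · rw [htail, hhead] at he
    exact he.symm

variable [Fintype V] [DecidableEq V]

theorem incidence_transpose_mulVec_apply (o : Orientation G) (x : V → ℝ) (e : G.edgeSet) :
    ((incidence o)ᵀ *ᵥ x) e = x (o.tail e) - x (o.head e) := by
  have hcol : (incidence o).col e = Pi.single (o.tail e) 1 - Pi.single (o.head e) 1 := by
    have hne := (o.adj_tail_head e).ne
    ext v
    simp only [incidence, col_apply, of_apply, Pi.sub_apply, Pi.single_apply]
    grind
  calc ((incidence o)ᵀ *ᵥ x) e = (incidence o).col e ⬝ᵥ x := rfl
    _ = x (o.tail e) - x (o.head e) := by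
      rw [hcol, sub_dotProduct, single_one_dotProduct, single_one_dotProduct]

theorem incidence_transpose_mulVec_eq_zero_iff_lapMatrix_mulVec_eq_zero [DecidableRel G.Adj]
    (o : Orientation G) {x : V → ℝ} : (incidence o)ᵀ *ᵥ x = 0 ↔ G.lapMatrix ℝ *ᵥ x = 0 := by
  rw [G.lapMatrix_mulVec_eq_zero_iff_forall_adj, ← o.forall_tail_eq_head_iff]
  simp only [funext_iff, incidence_transpose_mulVec_apply, Pi.zero_apply, sub_eq_zero]

theorem incidence_transpose_mulVec_eq_zero_iff_forall_reachable (o : Orientation G) {x : V → ℝ} :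
    (incidence o)ᵀ *ᵥ x = 0 ↔ ∀ u v, G.Reachable u v → x u = x v := by
  classical
  rw [incidence_transpose_mulVec_eq_zero_iff_lapMatrix_mulVec_eq_zero,
    G.lapMatrix_mulVec_eq_zero_iff_forall_reachable]

theorem rank_incidence_add_card_connectedComponent [DecidableRel G.Adj] (o : Orientation G) :
    (incidence o).rank + Nat.card G.ConnectedComponent = Fintype.card V := by
  classical
  have hker : LinearMap.ker (incidence o)ᵀ.mulVecLin = LinearMap.ker (G.lapMatrix ℝ).toLin' := by
    ext x
    simpa only [LinearMap.mem_ker, mulVecLin_apply, toLin'_apply] using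
      incidence_transpose_mulVec_eq_zero_iff_lapMatrix_mulVec_eq_zero o
  rw [Nat.card_eq_fintype_card, G.card_connectedComponent_eq_finrank_ker_toLin'_lapMatrix, ← hker,
    ← rank_transpose, Matrix.rank, LinearMap.finrank_range_add_finrank_ker,
    Module.finrank_fintype_fun_eq_card]

end Incidence

section Forest

variable {V : Type*} {T : SimpleGraph V}

/-- The side containing the tail of `e` of the cut that removing the edge `e` produces. It is meant
for a bridge `e`; otherwise it is the whole component of `e`. -/
def fundamentalCut (o : Orientation T) (e : T.edgeSet) : Set V :=
  {v | (T.deleteEdges {(e : Sym2 V)}).Reachable (o.tail e) v}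

theorem head_notMem_fundamentalCut (o : Orientation T) (hT : T.IsAcyclic) (e : T.edgeSet) :
    o.head e ∉ fundamentalCut o e := by
  have hbridge : T.IsBridge s(o.tail e, o.head e) :=
    SimpleGraph.isAcyclic_iff_forall_adj_isBridge.1 hT (o.adj_tail_head e)
  rw [SimpleGraph.isBridge_iff, o.mk_tail_head] at hbridge
  exact hbridge

theorem tail_mem_fundamentalCut_iff_of_ne (o : Orientation T) {e f : T.edgeSet} (hfe : f ≠ e) :
    o.tail f ∈ fundamentalCut o e ↔ o.head f ∈ fundamentalCut o e := by
  have hadj : (T.deleteEdges {(e : Sym2 V)}).Adj (o.tail f) (o.head f) := by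
    rw [SimpleGraph.deleteEdges_adj, o.mk_tail_head, Set.mem_singleton_iff]
    exact ⟨o.adj_tail_head f, Subtype.coe_injective.ne hfe⟩
  exact ⟨fun h => h.trans hadj.reachable, fun h => h.trans hadj.symm.reachable⟩

variable [Fintype V] [DecidableEq V]

theorem incidence_transpose_mulVec_indicator_fundamentalCut (o : Orientation T) (hT : T.IsAcyclic)
    (e : T.edgeSet) :
    (incidence o)ᵀ *ᵥ (fundamentalCut o e).indicator 1 = Pi.single e 1 := by
  classical
  ext f
  rw [incidence_transpose_mulVec_apply]
  simp only [Set.indicator_apply, Pi.one_apply]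
  obtain rfl | hfe := eq_or_ne f e
  · have htail : o.tail f ∈ fundamentalCut o f := SimpleGraph.Reachable.refl _
    rw [if_pos htail, if_neg (head_notMem_fundamentalCut o hT f), sub_zero, Pi.single_eq_same]
  · simp only [tail_mem_fundamentalCut_iff_of_ne o hfe, sub_self, Pi.single_eq_of_ne hfe]

theorem exists_mul_incidence_eq_one (o : Orientation T) (hT : T.IsAcyclic) :
    ∃ B : Matrix T.edgeSet V ℝ, B * incidence o = 1 := by
  refine ⟨of fun e => (fundamentalCut o e).indicator 1, transpose_injective ?_⟩
  ext f e
  rw [transpose_mul, transpose_one, one_apply, ← Pi.single_apply,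
    ← incidence_transpose_mulVec_indicator_fundamentalCut o hT e]
  rfl

theorem isSymm_edgeLaplacian (o : Orientation T) : (edgeLaplacian o).IsSymm := by
  rw [IsSymm, edgeLaplacian, transpose_mul, transpose_transpose]

variable [DecidableRel T.Adj]

theorem rank_incidence_of_isAcyclic (o : Orientation T) (hT : T.IsAcyclic) :
    (incidence o).rank = Fintype.card T.edgeSet :=
  let ⟨_, hB⟩ := exists_mul_incidence_eq_one o hT
  rank_eq_card_of_mul_eq_one hB

theorem isUnit_edgeLaplacian (o : Orientation T) (hT : T.IsAcyclic) : IsUnit (edgeLaplacian o) := by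
  rw [isUnit_iff_rank_eq_card, edgeLaplacian, rank_transpose_mul_self,
    rank_incidence_of_isAcyclic o hT]

theorem leftInverse_mul_incidence (o : Orientation T) (hT : T.IsAcyclic) :
    leftInverse o * incidence o = 1 := by
  rw [leftInverse, Matrix.mul_assoc]
  exact nonsing_inv_mul _ ((isUnit_iff_isUnit_det _).1 (isUnit_edgeLaplacian o hT))

theorem isSymm_incidence_mul_leftInverse (o : Orientation T) :
    (incidence o * leftInverse o).IsSymm := by
  rw [IsSymm, leftInverse, transpose_mul, transpose_mul, transpose_transpose,
    (isSymm_edgeLaplacian o).inv.eq, Matrix.mul_assoc]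

theorem incidence_mul_leftInverse_mul_incidence {H : SimpleGraph V} (o : Orientation T)
    (o' : Orientation H) (hT : T.IsAcyclic) (hHT : H.Reachable ≤ T.Reachable) :
    incidence o * leftInverse o * incidence o' = incidence o' := by
  refine mul_mul_eq_of_ker_transpose_le (leftInverse_mul_incidence o hT)
    (isSymm_incidence_mul_leftInverse o) fun x hx => ?_
  rw [incidence_transpose_mulVec_eq_zero_iff_forall_reachable] at hx ⊢
  exact fun u v huv => hx u v (hHT u v huv)

end Forest

section SpanningForest

variable {V : Type*} {G T : SimpleGraph V}

theorem card_connectedComponent_eq_of_reachable_eq (hreach : T.Reachable = G.Reachable) :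
    Nat.card T.ConnectedComponent = Nat.card G.ConnectedComponent := by
  rw [SimpleGraph.ConnectedComponent, SimpleGraph.ConnectedComponent, hreach]

theorem card_connectedComponent_of_connected (hG : G.Connected) :
    Nat.card G.ConnectedComponent = 1 := by
  have := hG.nonempty
  have := hG.preconnected.subsingleton_connectedComponent
  exact Nat.card_unique

variable [DecidableEq V] [DecidableRel T.Adj]

theorem incidence_submatrix_edgeSplit (o : Orientation G) (hTG : T ≤ G) :
    (incidence o).submatrix id (edgeSplit hTG) =
      fromCols (incidence (o.restrict hTG)) (incidence (o.restrict (sdiff_le : G \ T ≤ G))) := by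
  ext v (e | e) <;> rfl

variable [Fintype V]

theorem cutMatrix_eq_leftInverse_mul_incidence (o : Orientation G) (hTG : T ≤ G)
    (hT : T.IsAcyclic) : cutMatrix o hTG = leftInverse (o.restrict hTG) * incidence o := by
  have hsplit : cutMatrix o hTG = (leftInverse (o.restrict hTG) *
      (incidence o).submatrix id (edgeSplit hTG)).submatrix id (edgeSplit hTG).symm := by
    rw [incidence_submatrix_edgeSplit, mul_fromCols, leftInverse_mul_incidence _ hT]
    rfl
  rw [hsplit]
  ext e f
  simp [mul_apply]

theorem incidence_mul_cutMatrix (o : Orientation G) (hTG : T ≤ G) (hT : T.IsAcyclic)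
    (hreach : T.Reachable = G.Reachable) :
    incidence (o.restrict hTG) * cutMatrix o hTG = incidence o := by
  rw [cutMatrix_eq_leftInverse_mul_incidence o hTG hT, ← Matrix.mul_assoc]
  exact incidence_mul_leftInverse_mul_incidence _ o hT hreach.ge

variable [DecidableRel G.Adj]

theorem laplacian_eq_incidence_mul_weightedCutGram_mul (o : Orientation G) (w : G.edgeSet → ℝ)
    (hTG : T ≤ G) (hT : T.IsAcyclic) (hreach : T.Reachable = G.Reachable) :
    laplacian o w = incidence (o.restrict hTG) * weightedCutGram o w hTG *
      (incidence (o.restrict hTG))ᵀ := by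
  rw [laplacian, ← incidence_mul_cutMatrix o hTG hT hreach, weightedCutGram, transpose_mul]
  simp only [Matrix.mul_assoc]

theorem rank_weightedCutGram (o : Orientation G) (w : G.edgeSet → ℝ) (hTG : T ≤ G)
    (hT : T.IsAcyclic) (hreach : T.Reachable = G.Reachable) :
    (weightedCutGram o w hTG).rank = (laplacian o w).rank := by
  rw [laplacian_eq_incidence_mul_weightedCutGram_mul o w hTG hT hreach,
    rank_mul_mul_transpose_of_mul_eq_one (leftInverse_mul_incidence _ hT)]

theorem isUnit_weightedCutGram_iff (o : Orientation G) (w : G.edgeSet → ℝ) (hTG : T ≤ G)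
    (hT : T.IsAcyclic) (hreach : T.Reachable = G.Reachable) :
    IsUnit (weightedCutGram o w hTG) ↔
      (signature (laplacian o w) (laplacian_isHermitian o w)).2.2 =
        Nat.card G.ConnectedComponent := by
  have hnullity := rank_add_signature_zero (laplacian_isHermitian o w)
  have hcomponents := rank_incidence_add_card_connectedComponent (o.restrict hTG)
  rw [rank_incidence_of_isAcyclic _ hT, card_connectedComponent_eq_of_reachable_eq hreach]
    at hcomponents
  rw [isUnit_iff_rank_eq_card, rank_weightedCutGram o w hTG hT hreach]
  omega

theorem pinv_laplacian (o : Orientation G) (w : G.edgeSet → ℝ) (hTG : T ≤ G) (hT : T.IsAcyclic)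
    (hreach : T.Reachable = G.Reachable) (hRWR : IsUnit (weightedCutGram o w hTG)) :
    pinv (laplacian o w) = (leftInverse (o.restrict hTG))ᵀ * (weightedCutGram o w hTG)⁻¹ *
      leftInverse (o.restrict hTG) := by
  refine (pinv_spec _).unique ?_
  rw [laplacian_eq_incidence_mul_weightedCutGram_mul o w hTG hT hreach]
  exact isMoorePenrose_mul_mul_transpose (leftInverse_mul_incidence _ hT)
    (isSymm_incidence_mul_leftInverse _) hRWR

theorem inv_essentialEdgeLaplacian_mul_transpose_incidence (o : Orientation G)
    (w : G.edgeSet → ℝ) (hTG : T ≤ G) :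
    (essentialEdgeLaplacian o w hTG)⁻¹ * (incidence (o.restrict hTG))ᵀ =
      (weightedCutGram o w hTG)⁻¹ * leftInverse (o.restrict hTG) := by
  rw [essentialEdgeLaplacian, Matrix.mul_inv_rev, leftInverse, Matrix.mul_assoc]

end SpanningForest

end SignedLaplacian

open SignedLaplacian in
theorem mainTheorem5_general {V : Type*} [Fintype V] [DecidableEq V]
    (G T : SimpleGraph V) [DecidableRel G.Adj] [DecidableRel T.Adj]
    (o : Orientation G) (w : G.edgeSet → ℝ) (hTG : T ≤ G) (hT : T.IsAcyclic)
    (hreach : T.Reachable = G.Reachable)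
    (hnullity : (signature (laplacian o w) (laplacian_isHermitian o w)).2.2 =
      Nat.card G.ConnectedComponent) :
    IsUnit (edgeLaplacian (o.restrict hTG)) ∧
    leftInverse (o.restrict hTG) * incidence (o.restrict hTG) = 1 ∧
    IsUnit (weightedCutGram o w hTG) ∧
    IsUnit (essentialEdgeLaplacian o w hTG) ∧
    pinv (laplacian o w) = (leftInverse (o.restrict hTG))ᵀ * (weightedCutGram o w hTG)⁻¹ *
      leftInverse (o.restrict hTG) ∧
    pinv (laplacian o w) = (leftInverse (o.restrict hTG))ᵀ * (essentialEdgeLaplacian o w hTG)⁻¹ *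
      (incidence (o.restrict hTG))ᵀ ∧
    ∀ u v : V, effectiveResistance o w u v =
      (Pi.single u 1 - Pi.single v 1 : V → ℝ) ⬝ᵥ
        (((leftInverse (o.restrict hTG))ᵀ * (weightedCutGram o w hTG)⁻¹ *
          leftInverse (o.restrict hTG)) *ᵥ (Pi.single u 1 - Pi.single v 1 : V → ℝ)) := by
  have hLe := isUnit_edgeLaplacian (o.restrict hTG) hT
  have hRWR := (isUnit_weightedCutGram_iff o w hTG hT hreach).2 hnullity
  have hpinv := pinv_laplacian o w hTG hT hreach hRWR
  refine ⟨hLe, leftInverse_mul_incidence _ hT, hRWR, hLe.mul hRWR, hpinv, ?_, fun u v => ?_⟩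
  · rw [hpinv, Matrix.mul_assoc, Matrix.mul_assoc,
      inv_essentialEdgeLaplacian_mul_transpose_incidence]
  · rw [effectiveResistance, hpinv]

theorem mainTheorem5 {V : Type*} [Fintype V] [DecidableEq V]
    (G T : SimpleGraph V) [DecidableRel G.Adj] [DecidableRel T.Adj]
    (o : SignedLaplacian.Orientation G) (w : G.edgeSet → ℝ) (hw : ∀ e, w e ≠ 0)
    (hG : G.Connected) (hTG : T ≤ G) (hT : T.IsTree) (nPos nNeg : ℕ)
    (hsig : SignedLaplacian.signature (SignedLaplacian.laplacian o w)
      (SignedLaplacian.laplacian_isHermitian o w) = (nPos, nNeg, 1)) :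
    -- the inverses that occur are genuine, and `E_T^L` is a left inverse of `E_T`
    IsUnit (SignedLaplacian.edgeLaplacian (o.restrict hTG)) ∧
    SignedLaplacian.leftInverse (o.restrict hTG) *
      SignedLaplacian.incidence (o.restrict hTG) = 1 ∧
    IsUnit (SignedLaplacian.weightedCutGram o w hTG) ∧
    IsUnit (SignedLaplacian.essentialEdgeLaplacian o w hTG) ∧
    -- the two expressions for the pseudo-inverse
    SignedLaplacian.pinv (SignedLaplacian.laplacian o w) =
      (SignedLaplacian.leftInverse (o.restrict hTG)).transpose *
        (SignedLaplacian.weightedCutGram o w hTG)⁻¹ *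
        SignedLaplacian.leftInverse (o.restrict hTG) ∧
    SignedLaplacian.pinv (SignedLaplacian.laplacian o w) =
      (SignedLaplacian.leftInverse (o.restrict hTG)).transpose *
        (SignedLaplacian.essentialEdgeLaplacian o w hTG)⁻¹ *
        (SignedLaplacian.incidence (o.restrict hTG)).transpose ∧
    -- the effective resistance
    ∀ u v : V, SignedLaplacian.effectiveResistance o w u v =
      (Pi.single u 1 - Pi.single v 1 : V → ℝ) ⬝ᵥ
        (((SignedLaplacian.leftInverse (o.restrict hTG)).transpose *
          (SignedLaplacian.weightedCutGram o w hTG)⁻¹ *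
          SignedLaplacian.leftInverse (o.restrict hTG)) *ᵥ
            (Pi.single u 1 - Pi.single v 1 : V → ℝ)) := by
  have hreach := (SimpleGraph.maximal_isAcyclic_iff_reachable_eq hTG hT.isAcyclic).1
    ((hG.maximal_le_isAcyclic_iff_isTree hTG).2 hT)
  exact mainTheorem5_general G T o w hTG hT.isAcyclic hreach
    (by rw [hsig, SignedLaplacian.card_connectedComponent_of_connected hG])
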